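/- Let $k$ be a commutative ring, $A$ an associative unital $k$-algebra, and $B$ a $k$-subalgebra of $\operatorname{End}_k(A)$ containing the multiplication algebra $M(A)$, i.e. the subalgebra generated by all left and right multiplications $L_a,R_a$ ($a\in A$). Then $A$ is a left $B$-module whose submodules ("$B$-stable ideals") are two-sided ideals of $A$. Call $A$ $B$-semiprime if $K^2=0$ implies $K=0$ for every $B$-stable ideal $K$, and $B$-prime if $KL=0$ implies $K=0$ or $L=0$ for all $B$-stable ideals $K,L$. For a left $B$-module $M$, on which $a\in A$ acts through $L_a\in B$, put $M^B=\{m\in M: bm=(b\cdot 1_A)m\text{ for all } b\in B\}$; in particular $A^B$ is a central subring of $A$, and it acts on every $B$-module. Let $E(A)$ be an injective hull of the $B$-module $A$ and let $\widehat A=\sum_{f\in\operatorname{Hom}_B(A,E(A))}\operatorname{Im} f\supseteq A$ be the self-injective hull of $A$. Let $\sigma[A]$ be the category of submodules of $A$-generated $B$-modules. The Lambek torsion theory in $\sigma[A]$ has as torsion modules those $X\in\sigma[A]$ with $\operatorname{Hom}_B(X,\widehat A)=0$; the quotient module of $A$ is the homomorphism $A\to Q$ with $Q\in\sigma[A]$,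 with torsion kernel and cokernel, such that $Q$ is torsion free and injective with respect to monomorphisms in $\sigma[A]$ with torsion cokernel. Assume that $A$ is $B$-semiprime. Then: (1) $A\subseteq\widehat A$ is the quotient module of $A$ with respect to the Lambek torsion theory in $\sigma[A]$. The map $f\mapsto f(1_A)$ is a bijection $\operatorname{End}_B(\widehat A)\to\widehat A^B$; via this map $\widehat A^B$ is a ring, with product $f(1_A)\,g(1_A)=g(f(1_A))$, and it acts on $\widehat A$ by $xs=f(x)$ for $s=f(1_A)$. Moreover $$\widehat A^B\simeq\varinjlim\{\operatorname{Hom}_B(I,A): I\text{ an essential }B\text{-submodule of }A\},$$ where the class of $f:I\to A$ corresponds to the element $s\in\widehat A^B$ with $xs=f(x)$ for all $x\in I$; this isomorphism is $k$-linear and turns composition of (suitably restricted) maps into multiplication. (2) There is a left $B$-linear map $\phi:A\otimes_{A^B}\operatorname{End}_B(\widehat A)\to\widehat A$ with $\phi(a\otimes f)=f(a)$. It is surjective and its kernel is a two-sided ideal, so that $\widehat A$ becomes an associative unital $k$-algebra, with $$(as)(bt)=(ab)st\qquad(a,b\in A,\ s,t\in\widehat A^B).$$ It contains $A$ as a subalgebra,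 and $\widehat A^B$ is a central subalgebra of it. Let $\widehat B\subseteq\operatorname{End}_k(\widehat A)$ be the subalgebra generated by the image of $B$ and the multiplications by elements of $\widehat A^B$. Then $M(\widehat A)\subseteq\widehat B$, and: (3) $\widehat A$ is $\widehat B$-semiprime and is a self-injective $\widehat B$-module, i.e. every $\widehat B$-linear map from a $\widehat B$-submodule of $\widehat A$ to $\widehat A$ extends to an endomorphism of $\widehat A$. (4) $\widehat A$ is a non-singular $\widehat A^B$-module: no nonzero element of $\widehat A$ is annihilated by an essential ideal of $\widehat A^B$. (5) $A$ is $B$-prime if and only if $\widehat A$ is $\widehat B$-prime. -/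

import Mathlib

set_option maxSynthPendingDepth 3

open scoped TensorProduct

universe u v w

namespace CentralClosure

/-! ### Module-theoretic notions -/

section Modules

/-- A submodule is essential if it meets every nonzero submodule nontrivially. -/
def IsEssential {R : Type u} {M : Type v} [Ring R] [AddCommGroup M] [Module R M]
    (N : Submodule R M) : Prop :=
  ∀ L : Submodule R M, L ⊓ N = ⊥ → L = ⊥

/-- `ι : M → E` is an injective hull of the `R`-module `M`: an essential embedding of `M`
into an injective module. -/
structure IsInjectiveHull (R M E : Type v) [Ring R] [AddCommGroup M] [Module R M]
    [AddCommGroup E] [Module R E] (ι : M →ₗ[R] E) : Prop where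
  injective_module : Module.Injective R E
  injective : Function.Injective ι
  essential : IsEssential (LinearMap.range ι)

/-- The largest `M`-generated submodule of `E`, i.e. the sum of the images of all homomorphisms
`M → E`. If `E` is an injective hull of `M`, this is the self-injective hull of `M`. -/
def selfInjectiveHull (R M E : Type*) [Ring R] [AddCommGroup M] [Module R M]
    [AddCommGroup E] [Module R E] : Submodule R E :=
  ⨆ f : M →ₗ[R] E, LinearMap.range f

section Hull

variable (R M E : Type*) [Ring R] [AddCommGroup M] [Module R M] [AddCommGroup E] [Module R E]

/-- The self-injective hull as a type. -/
def Hull : Type _ := selfInjectiveHull R M E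

instance : AddCommGroup (Hull R M E) :=
  inferInstanceAs (AddCommGroup (selfInjectiveHull R M E))

instance : Module R (Hull R M E) :=
  inferInstanceAs (Module R (selfInjectiveHull R M E))

instance (k : Type*) [CommRing k] [Algebra k R] [Module k E] [IsScalarTower k R E] :
    Module k (Hull R M E) :=
  inferInstanceAs (Module k (selfInjectiveHull R M E))

instance (k : Type*) [CommRing k] [Algebra k R] [Module k E] [IsScalarTower k R E] :
    IsScalarTower k R (Hull R M E) :=
  inferInstanceAs (IsScalarTower k R (selfInjectiveHull R M E))

variable {R M E}

/-- The map from `M` to its self-injective hull given by the embedding `ι` into the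
injective hull. -/
def toHull (ι : M →ₗ[R] E) : M →ₗ[R] Hull R M E :=
  ι.codRestrict (selfInjectiveHull R M E)
    fun m => (le_iSup (fun f : M →ₗ[R] E => LinearMap.range f) ι) ⟨m, rfl⟩

end Hull

/-- `P` is generated by `M`. -/
def IsGenerated (R M P : Type*) [Ring R] [AddCommGroup M] [Module R M]
    [AddCommGroup P] [Module R P] : Prop :=
  (⨆ f : M →ₗ[R] P, LinearMap.range f) = ⊤

/-- `X` belongs to `σ[M]`: it is isomorphic to a submodule of an `M`-generated module. -/
def IsSubgenerated (R M X : Type v) [Ring R] [AddCommGroup M] [Module R M]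
    [AddCommGroup X] [Module R X] : Prop :=
  ∃ (P : Type v) (_ : AddCommGroup P) (_ : Module R P) (i : X →ₗ[R] P),
    IsGenerated R M P ∧ Function.Injective i

/-- `X` is a torsion module for the Lambek torsion theory in `σ[M]`, where `H` is the
self-injective hull of `M`: `X` lies in `σ[M]` and `Hom(X, H) = 0`. -/
def IsLambekTorsion (R M H X : Type v) [Ring R] [AddCommGroup M] [Module R M]
    [AddCommGroup H] [Module R H] [AddCommGroup X] [Module R X] : Prop :=
  IsSubgenerated R M X ∧ ∀ f : X →ₗ[R] H, f = 0

/-- `j : N → Q` is the quotient module of `N` with respect to the Lambek torsion theory in `σ[M]`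
(`H` is the self-injective hull of `M`): `Q` lies in `σ[M]`, the kernel and the cokernel of `j`
are torsion, `Q` is torsion free, and `Q` is injective with respect to all monomorphisms of `σ[M]`
with torsion cokernel. -/
structure IsLambekQuotient (R M H : Type v) [Ring R] [AddCommGroup M] [Module R M]
    [AddCommGroup H] [Module R H] {N Q : Type v} [AddCommGroup N] [Module R N]
    [AddCommGroup Q] [Module R Q] (j : N →ₗ[R] Q) : Prop where
  subgenerated : IsSubgenerated R M Q
  ker_torsion : IsLambekTorsion R M H (LinearMap.ker j)
  coker_torsion : IsLambekTorsion R M H (Q ⧸ LinearMap.range j)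
  torsionFree : ∀ L : Submodule R Q, IsLambekTorsion R M H L → L = ⊥
  torsion_injective : ∀ (K L : Type v) [AddCommGroup K] [Module R K] [AddCommGroup L] [Module R L]
    (i : K →ₗ[R] L), Function.Injective i → IsSubgenerated R M L →
    IsLambekTorsion R M H (L ⧸ LinearMap.range i) →
    ∀ f : K →ₗ[R] Q, ∃ g : L →ₗ[R] Q, g ∘ₗ i = f

/-- `M` is self-injective (`M`-injective): every homomorphism from a submodule of `M` to `M`
extends to an endomorphism of `M`. -/
def IsSelfInjective (R M : Type*) [Ring R] [AddCommGroup M] [Module R M] : Prop :=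
  ∀ (N : Submodule R M) (f : N →ₗ[R] M), ∃ g : M →ₗ[R] M, ∀ x : N, g x = f x

/-- `M` is non-singular: no nonzero element has an essential annihilator. -/
def IsNonsingular (R M : Type*) [Ring R] [AddCommGroup M] [Module R M] : Prop :=
  ∀ m : M, IsEssential (LinearMap.ker (LinearMap.toSpanSingleton R M m)) → m = 0

/-- The essential submodules of `M`, ordered by reverse inclusion. -/
abbrev EssentialSubmodule (R M : Type*) [Ring R] [AddCommGroup M] [Module R M] : Type _ :=
  {I : Submodule R M // IsEssential I}ᵒᵈ

/-- The underlying submodule. -/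
def EssentialSubmodule.sub {R M : Type*} [Ring R] [AddCommGroup M] [Module R M]
    (I : EssentialSubmodule R M) : Submodule R M :=
  (OrderDual.ofDual I).1

section HomLimit

variable (k : Type u) [CommRing k] (R : Type v) [Ring R] (M : Type w) [AddCommGroup M]
  [Module R M] [Module k M] [SMulCommClass R k M]

/-- Restriction of homomorphisms `I → M` to an essential submodule `J ⊆ I`. -/
def restrictHom (I J : EssentialSubmodule R M) (h : I ≤ J) :
    (I.sub →ₗ[R] M) →ₗ[k] (J.sub →ₗ[R] M) where
  toFun f := f ∘ₗ Submodule.inclusion h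
  map_add' _ _ := rfl
  map_smul' _ _ := rfl

open Classical in
/-- The direct limit of the `Hom_R(I, M)` along restriction, where `I` runs through the essential
submodules of `M`. -/
abbrev HomLimit : Type _ :=
  Module.DirectLimit (fun I : EssentialSubmodule R M => I.sub →ₗ[R] M) (restrictHom k R M)

open Classical in
variable {R M} in
/-- The class of `f : I → M` in the direct limit. -/
noncomputable def HomLimit.mk (I : EssentialSubmodule R M) (f : I.sub →ₗ[R] M) :
    HomLimit k R M :=
  Module.DirectLimit.of k (EssentialSubmodule R M)
    (fun I : EssentialSubmodule R M => I.sub →ₗ[R] M) (restrictHom k R M) I f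

end HomLimit

end Modules

/-! ### Algebras `A` with a subalgebra `B` of `End(A)` -/

section Algebras

variable {k : Type u} [CommRing k] {A : Type v} [Ring A] [Algebra k A]

variable (k A) in
/-- The multiplication algebra `M(A)`. -/
def multiplicationAlgebra : Subalgebra k (Module.End k A) :=
  Algebra.adjoin k
    (Set.range (fun a : A => LinearMap.mulLeft k a) ∪
      Set.range (fun a : A => LinearMap.mulRight k a))

/-- The `B`-stable ideal `I` of `A` is `B`-prime. (If `M(A) ⊆ B`, the `B`-stable ideals are the
`B`-submodules of `A`.) -/
def IsBPrimeIdeal {B : Subalgebra k (Module.End k A)} (I : Submodule B A) : Prop :=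
  ∀ K L : Submodule B A, (∀ x ∈ K, ∀ y ∈ L, x * y ∈ I) → K ≤ I ∨ L ≤ I

/-- The `B`-stable ideal `I` of `A` is `B`-semiprime. -/
def IsBSemiprimeIdeal {B : Subalgebra k (Module.End k A)} (I : Submodule B A) : Prop :=
  ∀ K : Submodule B A, (∀ x ∈ K, ∀ y ∈ K, x * y ∈ I) → K ≤ I

/-- `A` is `B`-prime. -/
def IsBPrime (B : Subalgebra k (Module.End k A)) : Prop :=
  IsBPrimeIdeal (⊥ : Submodule B A)

/-- `A` is `B`-semiprime. -/
def IsBSemiprime (B : Subalgebra k (Module.End k A)) : Prop :=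
  IsBSemiprimeIdeal (⊥ : Submodule B A)

/-- Shortcut instance. -/
instance (B : Subalgebra k (Module.End k A)) : Ring B := Subalgebra.toRing B

variable {B : Subalgebra k (Module.End k A)} (hB : multiplicationAlgebra k A ≤ B)

/-- Left multiplication by `a`, as an element of `B`. -/
def lmul (a : A) : B :=
  ⟨LinearMap.mulLeft k a, hB (Algebra.subset_adjoin (Or.inl ⟨a, rfl⟩))⟩

/-- Right multiplication by `a`, as an element of `B`. -/
def rmul (a : A) : B :=
  ⟨LinearMap.mulRight k a, hB (Algebra.subset_adjoin (Or.inr ⟨a, rfl⟩))⟩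

theorem B_smul_def (b : B) (a : A) : b • a = (b : Module.End k A) a := rfl

@[simp] theorem lmul_smul (a x : A) : lmul hB a • x = a * x := rfl

@[simp] theorem rmul_smul (a x : A) : rmul hB a • x = x * a := rfl

/-- The submodule `M^B` of `B`-invariants of a `B`-module `M`: all `m` with
`b m = (b · 1) m` for all `b ∈ B`, where `b · 1 ∈ A` acts on `M` through its left multiplication. -/
def invariants (M : Type w) [AddCommGroup M] [Module B M] [Module k M] [IsScalarTower k B M] :
    Submodule k M where
  carrier := {m | ∀ b : B, b • m = lmul hB (b • (1 : A)) • m}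
  zero_mem' := by intro b; simp
  add_mem' := by
    intro x y hx hy b
    rw [smul_add, smul_add, hx b, hy b]
  smul_mem' := by
    intro c x hx b
    rw [← algebraMap_smul B c x, ← mul_smul, ← mul_smul, ← Algebra.commutes, ← Algebra.commutes,
      mul_smul, mul_smul, hx b]

theorem mem_invariants_iff {x : A} :
    x ∈ invariants hB A ↔ ∀ b : B, b • x = (b • (1 : A)) * x := Iff.rfl

theorem smul_mul_invariant {x : A} (hx : x ∈ invariants hB A) (b : B) (a : A) :
    b • (a * x) = (b • a) * x := by
  have h := hx (b * lmul hB a)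
  simpa [mul_smul] using h

theorem invariant_comm {x : A} (hx : x ∈ invariants hB A) (a : A) : x * a = a * x := by
  have h := hx (rmul hB a)
  simpa using h

/-- The ring `A^B` of `B`-invariants of `A`. -/
def invariantSubalgebra : Subalgebra k A where
  carrier := invariants hB A
  zero_mem' := zero_mem _
  add_mem' := add_mem
  mul_mem' := by
    intro x y hx hy
    show x * y ∈ invariants hB A
    intro b
    rw [smul_mul_invariant hB hy b x, (mem_invariants_iff hB).1 hx b, lmul_smul, mul_assoc]
  algebraMap_mem' := by
    intro c
    show algebraMap k A c ∈ invariants hB A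
    rw [Algebra.algebraMap_eq_smul_one]
    refine (invariants hB A).smul_mem c ?_
    intro b
    simp

instance invariantCommRing : CommRing (invariantSubalgebra hB) :=
  { (inferInstance : Ring (invariantSubalgebra hB)) with
    mul_comm := fun x y => Subtype.ext (invariant_comm hB x.2 y) }

/-- `A` is an algebra over the central subring `A^B`. -/
instance invariantAlgebra : Algebra (invariantSubalgebra hB) A :=
  { (inferInstance : Module (invariantSubalgebra hB) A) with
    algebraMap := (invariantSubalgebra hB).val.toRingHom
    commutes' := fun x a => invariant_comm hB x.2 a
    smul_def' := fun _ _ => rfl }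

instance invariant_smulCommClass : SMulCommClass (invariantSubalgebra hB) B A where
  smul_comm x b a := by
    show (x : A) * (b • a) = b • ((x : A) * a)
    rw [invariant_comm hB x.2, invariant_comm hB x.2, smul_mul_invariant hB x.2]

/-- Left multiplication by an invariant element is central in `B`. -/
theorem lmul_commute (x : invariantSubalgebra hB) (b : B) :
    lmul hB (x : A) * b = b * lmul hB (x : A) := by
  apply Subtype.ext
  ext a
  exact smul_comm x b a

/-- `A^B` acts on every `B`-module by the central elements `L_x` of `B`; this makes the ring of
`B`-endomorphisms an algebra over `A^B`. -/
instance invariantEndAlgebra (M : Type w) [AddCommGroup M] [Module B M] :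
    Algebra (invariantSubalgebra hB) (Module.End B M) :=
  RingHom.toAlgebra'
    { toFun := fun x =>
        { toFun := fun m => lmul hB (x : A) • m
          map_add' := fun m n => smul_add _ m n
          map_smul' := fun b m => by
            simp only [RingHom.id_apply]
            rw [← mul_smul, lmul_commute, mul_smul] }
      map_one' := by
        ext m
        have h : lmul hB (1 : A) = 1 := by
          apply Subtype.ext
          ext a
          simp [lmul]
        simp [h]
      map_mul' := fun x y => by
        ext m
        have h : lmul hB ((x : A) * y) = lmul hB (x : A) * lmul hB (y : A) := by
          apply Subtype.ext
          ext a
          simp [lmul]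
        show lmul hB ((x : A) * y) • m = lmul hB (x : A) • lmul hB (y : A) • m
        rw [h, mul_smul]
      map_zero' := by
        ext m
        have h : lmul hB (0 : A) = 0 := by
          apply Subtype.ext
          ext a
          simp [lmul]
        simp [h]
      map_add' := fun x y => by
        ext m
        have h : lmul hB ((x : A) + y) = lmul hB (x : A) + lmul hB (y : A) := by
          apply Subtype.ext
          ext a
          simp [lmul, add_mul]
        simp [h, add_smul] }
    (fun x f => by
      ext m
      exact (f.map_smul (lmul hB (x : A)) m).symm)

/-- The tensor product `A ⊗ End_B(M)` over `A^B`. -/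
abbrev InvariantTensor (M : Type w) [AddCommGroup M] [Module B M] : Type _ :=
  A ⊗[invariantSubalgebra hB] Module.End B M

/-- The usual ring structure of the tensor product of two algebras. -/
noncomputable instance (M : Type w) [AddCommGroup M] [Module B M] : Ring (InvariantTensor hB M) :=
  Algebra.TensorProduct.instRing

/-- `B` acts on the tensor product through the first factor. -/
noncomputable instance (M : Type w) [AddCommGroup M] [Module B M] :
    Module B (InvariantTensor hB M) :=
  TensorProduct.leftModule

end Algebras

/-! ### Algebra structures on a given module -/

/-- The structure of an associative unital `k`-algebra on a given `k`-module. -/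
structure AlgebraStructure (k : Type u) (V : Type v) [CommRing k] [AddCommGroup V]
    [Module k V] where
  /-- the multiplication -/
  mul : V →ₗ[k] V →ₗ[k] V
  /-- the unit -/
  one : V
  mul_assoc : ∀ x y z, mul (mul x y) z = mul x (mul y z)
  one_mul : ∀ x, mul one x = x
  mul_one : ∀ x, mul x one = x

namespace AlgebraStructure

variable {k : Type u} {V : Type v} [CommRing k] [AddCommGroup V] [Module k V]

/-- The ring given by an algebra structure (its additive group is the given one). -/
abbrev toRing (μ : AlgebraStructure k V) : Ring V :=
  { (inferInstance : AddCommGroup V) with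
    mul := fun x y => μ.mul x y
    one := μ.one
    mul_assoc := μ.mul_assoc
    one_mul := μ.one_mul
    mul_one := μ.mul_one
    left_distrib := fun x y z => (μ.mul x).map_add y z
    right_distrib := fun x y z => by
      show μ.mul (x + y) z = μ.mul x z + μ.mul y z
      simp
    zero_mul := fun x => by
      show μ.mul 0 x = 0
      simp
    mul_zero := fun x => (μ.mul x).map_zero }

/-- The algebra given by an algebra structure (its scalar multiplication is the given one). -/
abbrev toAlgebra (μ : AlgebraStructure k V) : letI := μ.toRing; Algebra k V :=
  letI := μ.toRing
  Algebra.ofModule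
    (fun r x y => by
      show μ.mul (r • x) y = r • μ.mul x y
      simp)
    (fun r x y => (μ.mul x).map_smul r y)

end AlgebraStructure

/-- The subalgebra `⟨B, V^B⟩` of `End(V)` generated by the image of `B` and by the
multiplications with elements of `V^B`, for a `B`-module `V` with an algebra structure `μ`. -/
def extendedB {k : Type u} [CommRing k] {A : Type v} [Ring A] [Algebra k A]
    {B : Subalgebra k (Module.End k A)} (hB : multiplicationAlgebra k A ≤ B)
    {V : Type w} [AddCommGroup V] [Module B V] [Module k V] [IsScalarTower k B V]
    (μ : AlgebraStructure k V) : Subalgebra k (Module.End k V) :=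
  Algebra.adjoin k
    (Set.range (Algebra.lsmul k k V : B →ₐ[k] Module.End k V) ∪
      (fun s => μ.mul s) '' (invariants hB V : Set V))

end CentralClosure

open CentralClosure

/-! Write `V` for the self-injective hull, regarded as containing `A`. Only four of its properties
are used (`IsSelfInjectiveHull`): `A` embeds in `V`, the embedding is essential, `V` is generated by
`A`, and `V` is injective in `σ[A]`.

Two facts carry the proof. First, semiprimeness kills every `B`-map `h : A → V` with essential
kernel (`hom_eq_zero`): the ideal `h(A) ∩ A ∩ ker h` has square zero. Since `A` generates `V`, the
same holds for endomorphisms of `V` (`end_eq_zero`), so an endomorphism is determined by its values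
on an essential ideal of `A`, and by its value at `1`. This gives the Lambek quotient, the
identification of `End_B(V)` with the invariants, and the direct limit of partial maps `I → A`, each
of which has a unique extension to `V` when `I` is essential.

Second, `End_B(V)` is commutative (`end_comm`): if `g x` and `f y` lie in `A`, both composites send
`x y` to `g(x) f(y)`, and such products suffice by semiprimeness. Hence the kernel of `a ⊗ f ↦ f a`
is two-sided and `V` inherits the product `f(a) g(b) = f(g(ab))`. Left and right multiplication by
`f(a)` are `f ∘ L_a` and `f ∘ R_a`, and multiplication by an invariant is a `B`-endomorphism, so the
extended algebra is generated by `B` and `End_B(V)`. Self-injectivity then follows from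
commutativity, semiprimeness by contracting ideals to `A`, and primeness by contraction and
extension. Non-singularity uses the endomorphism of `exists_end_apply_eq_self`. -/

namespace CentralClosure

/-! ### Essential submodules and complements -/

section Essential

variable {R M N : Type*} [Ring R] [AddCommGroup M] [Module R M] [AddCommGroup N] [Module R N]

theorem IsEssential.mono {K L : Submodule R M} (hK : IsEssential K) (h : K ≤ L) :
    IsEssential L := fun P hP => hK P (le_bot_iff.1 ((inf_le_inf_left P h).trans hP.le))

theorem isEssential_top : IsEssential (⊤ : Submodule R M) := fun L hL => by simpa using hL

theorem IsEssential.inf {K L : Submodule R M} (hK : IsEssential K) (hL : IsEssential L) :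
    IsEssential (K ⊓ L) := fun P hP => hK P (hL _ (by rw [inf_assoc, hP]))

theorem IsEssential.comap {K : Submodule R N} (hK : IsEssential K) (g : M →ₗ[R] N) :
    IsEssential (K.comap g) := by
  intro L hL
  have h1 : L.map g = ⊥ := by
    apply hK
    rw [eq_bot_iff]
    rintro _ ⟨⟨l, hl, rfl⟩, hk⟩
    have : l ∈ L ⊓ K.comap g := ⟨hl, hk⟩
    rw [hL, Submodule.mem_bot] at this
    simp [this]
  rw [← hL, eq_comm, inf_eq_left]
  intro l hl
  have : g l ∈ L.map g := ⟨l, hl, rfl⟩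
  rw [h1, Submodule.mem_bot] at this
  simp [this]

/-- Every submodule `K` has a complement `C` up to essential extension. -/
theorem exists_disjoint_isEssential_sup (K : Submodule R M) :
    ∃ C : Submodule R M, K ⊓ C = ⊥ ∧ IsEssential (K ⊔ C) := by
  obtain ⟨C, hC⟩ := zorn_le₀ {C : Submodule R M | Disjoint K C} (by
    intro c hc hchain
    refine ⟨sSup c, ?_, fun z hz => le_sSup hz⟩
    exact (hchain.directedOn.disjoint_sSup_right).2 fun b hb => hc hb)
  -- If `L` misses `K ⊔ C`, then `C ⊔ L` still misses `K`, so maximality of `C` puts `L` inside `C`.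
  refine ⟨C, hC.prop.eq_bot, fun L hL => ?_⟩
  have h1 : Disjoint K (C ⊔ L) :=
    Disjoint.disjoint_sup_right_of_disjoint_sup_left hC.prop (disjoint_iff.2 (by rwa [inf_comm]))
  have h2 : L ≤ C := le_sup_right.trans (hC.le_of_ge h1 le_sup_left)
  rw [← hL, eq_comm, inf_eq_left]
  exact h2.trans le_sup_right

end Essential

/-! ### The category `σ[M]` and the self-injective hull -/

section Generated

variable {R M X Y : Type v} [Ring R] [AddCommGroup M] [Module R M] [AddCommGroup X] [Module R X]
  [AddCommGroup Y] [Module R Y]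

theorem isGenerated_self : IsGenerated R M M :=
  top_le_iff.1 ((LinearMap.range_id (R := R) (M := M)).ge.trans
    (le_iSup (fun f : M →ₗ[R] M => LinearMap.range f) LinearMap.id))

theorem IsGenerated.of_surjective (h : IsGenerated R M X) (g : X →ₗ[R] Y)
    (hg : Function.Surjective g) : IsGenerated R M Y := by
  unfold IsGenerated at *
  rw [← top_le_iff, ← LinearMap.range_eq_top.2 hg, LinearMap.range_eq_map, ← h, Submodule.map_iSup]
  refine iSup_le fun f => ?_
  rw [← LinearMap.range_comp]
  exact le_iSup (fun f : M →ₗ[R] Y => LinearMap.range f) (g ∘ₗ f)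

theorem IsGenerated.subgenerated (h : IsGenerated R M X) : IsSubgenerated R M X :=
  ⟨X, _, _, LinearMap.id, h, Function.injective_id⟩

theorem isSubgenerated_of_injective (i : X →ₗ[R] Y) (hi : Function.Injective i)
    (h : IsSubgenerated R M Y) : IsSubgenerated R M X := by
  obtain ⟨P, _, _, e, hP, he⟩ := h
  exact ⟨P, _, _, e ∘ₗ i, hP, he.comp hi⟩

theorem IsGenerated.induction_on (h : IsGenerated R M X) {p : X → Prop}
    (hom : ∀ (f : M →ₗ[R] X) (m : M), p (f m)) (add : ∀ x y, p x → p y → p (x + y)) (x : X) :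
    p x := by
  have hx : x ∈ ⨆ f : M →ₗ[R] X, LinearMap.range f := by rw [h]; trivial
  induction hx using Submodule.iSup_induction' with
  | mem f x hx => obtain ⟨m, rfl⟩ := hx; exact hom f m
  | zero => simpa using hom 0 0
  | add x y _ _ hx hy => exact add x y hx hy

/-- The properties that characterize the self-injective hull `j : M → V` of `M`. -/
structure IsSelfInjectiveHull (R M V : Type v) [Ring R] [AddCommGroup M] [Module R M]
    [AddCommGroup V] [Module R V] (j : M →ₗ[R] V) : Prop where
  injective : Function.Injective j
  essential : IsEssential (LinearMap.range j)
  generated : IsGenerated R M V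
  extend : ∀ {X Y : Type v} [AddCommGroup X] [Module R X] [AddCommGroup Y] [Module R Y]
    (i : X →ₗ[R] Y), Function.Injective i → IsSubgenerated R M Y →
    ∀ f : X →ₗ[R] V, ∃ g : Y →ₗ[R] V, g ∘ₗ i = f

/-- A map on `X` extends, by injectivity of `E`, to an `M`-generated module containing `X`, and
images of `M`-generated modules lie in the trace of `M` in `E`. Hence the hull inherits injectivity
within `σ[M]` from `E`. -/
theorem mem_selfInjectiveHull_of_isSubgenerated {E : Type v} [AddCommGroup E] [Module R E]
    (hE : Module.Injective R E) (h : IsSubgenerated R M X) (g : X →ₗ[R] E) (x : X) :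
    g x ∈ selfInjectiveHull R M E := by
  obtain ⟨P, _, _, i, hP, hi⟩ := h
  obtain ⟨g', hg'⟩ := hE.out i hi g
  rw [← hg']
  induction i x using hP.induction_on with
  | hom f m => exact (le_iSup (fun f : M →ₗ[R] E => LinearMap.range f) (g' ∘ₗ f)) ⟨m, rfl⟩
  | add x y hx hy => rw [map_add]; exact add_mem hx hy

theorem IsInjectiveHull.isSelfInjectiveHull {E : Type v} [AddCommGroup E] [Module R E]
    {ι : M →ₗ[R] E} (hE : IsInjectiveHull R M E ι) :
    IsSelfInjectiveHull R M (Hull R M E) (toHull ι) where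
  injective x y h := hE.injective (congrArg Subtype.val h)
  essential := by
    have h : LinearMap.range (toHull ι)
        = (LinearMap.range ι).comap (selfInjectiveHull R M E).subtype := by
      ext x
      constructor
      · rintro ⟨m, rfl⟩
        exact ⟨m, rfl⟩
      · rintro ⟨m, hm⟩
        exact ⟨m, Subtype.ext hm⟩
    rw [h]
    exact hE.essential.comap _
  generated := by
    have h : ∀ x (hx : x ∈ selfInjectiveHull R M E),
        (⟨x, hx⟩ : Hull R M E) ∈ ⨆ f : M →ₗ[R] Hull R M E, LinearMap.range f := by
      intro x hx
      induction hx using Submodule.iSup_induction' with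
      | mem f x hx =>
        obtain ⟨m, rfl⟩ := hx
        exact (le_iSup (fun f : M →ₗ[R] Hull R M E => LinearMap.range f) (toHull f)) ⟨m, rfl⟩
      | zero => exact zero_mem _
      | add x y _ _ hx hy => exact add_mem hx hy
    exact eq_top_iff.2 fun x _ => h x.1 x.2
  extend i hi hY f := by
    obtain ⟨g, hg⟩ := hE.injective_module.out i hi ((selfInjectiveHull R M E).subtype ∘ₗ f)
    exact ⟨g.codRestrict (selfInjectiveHull R M E)
        (mem_selfInjectiveHull_of_isSubgenerated hE.injective_module hY g),
      LinearMap.ext fun x => Subtype.ext (hg x)⟩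

namespace IsSelfInjectiveHull

variable {V : Type v} [AddCommGroup V] [Module R V] {j : M →ₗ[R] V}

theorem eq_bot_of_comap (hj : IsSelfInjectiveHull R M V j) {N : Submodule R V}
    (h : N.comap j = ⊥) : N = ⊥ := by
  apply hj.essential
  rw [eq_bot_iff]
  rintro _ ⟨hN, m, rfl⟩
  have : m ∈ N.comap j := hN
  rw [h, Submodule.mem_bot] at this
  simp [this]

theorem exists_extend (hj : IsSelfInjectiveHull R M V j) (f : M →ₗ[R] V) :
    ∃ g : Module.End R V, ∀ m, g (j m) = f m := by
  obtain ⟨g, hg⟩ := hj.extend j hj.injective hj.generated.subgenerated f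
  exact ⟨g, fun m => LinearMap.congr_fun hg m⟩

theorem induction_on (hj : IsSelfInjectiveHull R M V j) {p : V → Prop}
    (apply : ∀ (f : Module.End R V) (m : M), p (f (j m)))
    (add : ∀ x y, p x → p y → p (x + y)) (x : V) : p x := by
  refine hj.generated.induction_on (fun f m => ?_) add x
  obtain ⟨g, hg⟩ := hj.exists_extend f
  exact hg m ▸ apply g m

end IsSelfInjectiveHull

end Generated

/-! ### Consequences of semiprimeness for maps into the hull -/

section Hull

variable {k : Type u} [CommRing k] {A : Type v} [Ring A] [Algebra k A]
  {B : Subalgebra k (Module.End k A)} {V : Type v} [AddCommGroup V] [Module B V]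
  {j : A →ₗ[B] V}

namespace IsSelfInjectiveHull

theorem hom_eq_zero (hj : IsSelfInjectiveHull B A V j) (hB : multiplicationAlgebra k A ≤ B)
    (hA : IsBSemiprime B) (h : A →ₗ[B] V) (hh : IsEssential (LinearMap.ker h)) : h = 0 := by
  have hP : (LinearMap.range h).comap j = ⊥ := by
    apply hh
    rw [eq_bot_iff]
    refine hA _ ?_
    rintro a ⟨⟨x, hx⟩, -⟩ b ⟨-, hb⟩
    -- With `a = h x` and `h b = 0`: `a b = (h x) b = h (x b) = x (h b) = 0`.
    have h1 : j (a * b) = 0 := by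
      rw [← rmul_smul hB, map_smul, ← hx, ← map_smul, rmul_smul, ← lmul_smul hB, map_smul,
        LinearMap.mem_ker.1 hb, smul_zero]
    exact (Submodule.mem_bot _).2 (hj.injective (by rw [h1, map_zero]))
  exact LinearMap.range_eq_bot.1 (hj.eq_bot_of_comap hP)

theorem end_eq_zero (hj : IsSelfInjectiveHull B A V j) (hB : multiplicationAlgebra k A ≤ B)
    (hA : IsBSemiprime B) (f : V →ₗ[B] V) (hf : IsEssential (LinearMap.ker f)) : f = 0 := by
  ext x
  induction x using hj.generated.induction_on with
  | hom g a =>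
    exact LinearMap.congr_fun (hj.hom_eq_zero hB hA (f ∘ₗ g) (hf.comap g)) a
  | add x y hx hy => rw [map_add, hx, hy, map_add]

theorem end_ext (hj : IsSelfInjectiveHull B A V j) (hB : multiplicationAlgebra k A ≤ B)
    (hA : IsBSemiprime B) {f g : V →ₗ[B] V} {I : Submodule B A} (hI : IsEssential I)
    (h : ∀ x ∈ I, f (j x) = g (j x)) : f = g := by
  have h1 := hj.hom_eq_zero hB hA ((f - g) ∘ₗ j) (hI.mono fun x hx => by simp [h x hx])
  refine sub_eq_zero.1 (hj.end_eq_zero hB hA _ (hj.essential.mono ?_))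
  rintro _ ⟨a, rfl⟩
  exact LinearMap.congr_fun h1 a

theorem end_ext_one (hj : IsSelfInjectiveHull B A V j) (hB : multiplicationAlgebra k A ≤ B)
    (hA : IsBSemiprime B) {f g : V →ₗ[B] V} (h : f (j 1) = g (j 1)) : f = g := by
  refine hj.end_ext hB hA isEssential_top fun x _ => ?_
  rw [← mul_one x, ← lmul_smul hB, map_smul, map_smul, map_smul, h]

/-- The kernel of the commutator, restricted to `A`, is essential: if `L` misses it, products of
elements of `L ⊓ I` lie in both `L` and that kernel, so `L ⊓ I` has square zero and vanishes. -/
theorem end_comm (hj : IsSelfInjectiveHull B A V j) (hB : multiplicationAlgebra k A ≤ B)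
    (hA : IsBSemiprime B) (f g : V →ₗ[B] V) (x : V) : f (g x) = g (f x) := by
  have key : f ∘ₗ g = g ∘ₗ f := by
    set I : Submodule B A := (LinearMap.range j).comap (f ∘ₗ j) ⊓ (LinearMap.range j).comap (g ∘ₗ j)
    have hI : IsEssential I := (hj.essential.comap _).inf (hj.essential.comap _)
    refine hj.end_ext hB hA (I := LinearMap.ker ((f ∘ₗ g - g ∘ₗ f) ∘ₗ j)) ?_ fun x hx => ?_
    · intro L hL
      apply hI
      rw [eq_bot_iff]
      refine hA _ ?_
      rintro x ⟨hx, -, c, hc⟩ y ⟨-, ⟨d, hd⟩, -⟩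
      rw [← hL]
      refine ⟨?_, ?_⟩
      · rw [← rmul_smul hB]
        exact L.smul_mem _ hx
      · have h1 : f (g (j (x * y))) = j (c * d) := by
          rw [← rmul_smul hB, map_smul, map_smul]
          change f (rmul hB y • (g ∘ₗ j) x) = _
          rw [← hc, ← map_smul, rmul_smul, ← lmul_smul hB, map_smul, map_smul]
          change lmul hB c • (f ∘ₗ j) y = _
          rw [← hd, ← map_smul, lmul_smul]
        have h2 : g (f (j (x * y))) = j (c * d) := by
          rw [← lmul_smul hB, map_smul, map_smul]
          change g (lmul hB x • (f ∘ₗ j) y) = _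
          rw [← hd, ← map_smul, lmul_smul, ← rmul_smul hB, map_smul, map_smul]
          change rmul hB d • (g ∘ₗ j) x = _
          rw [← hc, ← map_smul, rmul_smul]
        simp [h1, h2]
    · exact sub_eq_zero.1 hx
  exact LinearMap.congr_fun key x

/-- `V` is the quotient module of `A` for the Lambek torsion theory. -/
theorem isLambekQuotient (hj : IsSelfInjectiveHull B A V j) (hB : multiplicationAlgebra k A ≤ B)
    (hA : IsBSemiprime B) : IsLambekQuotient B A V j where
  subgenerated := hj.generated.subgenerated
  ker_torsion := by
    refine ⟨isSubgenerated_of_injective _ (LinearMap.ker j).injective_subtype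
      isGenerated_self.subgenerated, fun f => LinearMap.ext fun x => ?_⟩
    have hx : x = 0 := Subtype.ext (hj.injective (by rw [LinearMap.mem_ker.1 x.2]; simp))
    simp [hx]
  coker_torsion := by
    refine ⟨(hj.generated.of_surjective _ (Submodule.mkQ_surjective _)).subgenerated, fun f => ?_⟩
    -- A map out of the cokernel is an endomorphism of `V` vanishing on the essential submodule `A`.
    have h := hj.end_eq_zero hB hA (f ∘ₗ (LinearMap.range j).mkQ) (hj.essential.mono fun x hx => by
      rw [LinearMap.mem_ker, LinearMap.comp_apply, Submodule.mkQ_apply,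
        (Submodule.Quotient.mk_eq_zero _).2 hx, map_zero])
    ext x
    exact LinearMap.congr_fun h x
  torsionFree L hL := (Submodule.eq_bot_iff L).2 fun x hx =>
    LinearMap.congr_fun (hL.2 L.subtype) ⟨x, hx⟩
  torsion_injective _ _ _ _ _ _ i hi hL _ f := hj.extend i hi hL f

theorem lmul_smul_apply_one (hB : multiplicationAlgebra k A ≤ B) (f : V →ₗ[B] V) (a : A) :
    lmul hB a • f (j 1) = f (j a) := by
  rw [← map_smul, ← map_smul, lmul_smul, mul_one]

variable [Module k V] [IsScalarTower k B V]

/-- Invariance of `s` is what makes `a ↦ a s` a `B`-linear map on `A`; injectivity of the hull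
extends it to `V`. -/
theorem exists_end_of_mem_invariants (hj : IsSelfInjectiveHull B A V j)
    (hB : multiplicationAlgebra k A ≤ B) {s : V} (hs : s ∈ invariants hB V) :
    ∃ f : Module.End B V, f (j 1) = s := by
  have hlin : ∀ (b : B) (a : A), lmul hB (b • a) • s = b • lmul hB a • s := by
    intro b a
    rw [← mul_smul, hs (b * lmul hB a), mul_smul, lmul_smul, mul_one]
  obtain ⟨g, hg⟩ := hj.exists_extend
    { toFun := fun a => lmul hB a • s
      map_add' := fun a b => by
        rw [← add_smul]
        congr 1
        ext x
        exact add_mul a b x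
      map_smul' := hlin }
  refine ⟨g, (hg 1).trans ?_⟩
  have h := hs 1
  rw [one_smul, one_smul] at h
  exact h.symm

theorem apply_one_mem_invariants (hB : multiplicationAlgebra k A ≤ B) (f : V →ₗ[B] V) :
    f (j 1) ∈ invariants hB V := by
  intro b
  rw [← map_smul, ← map_smul, ← map_smul, ← map_smul, lmul_smul, mul_one]

theorem bijOn_apply_one (hj : IsSelfInjectiveHull B A V j) (hB : multiplicationAlgebra k A ≤ B)
    (hA : IsBSemiprime B) :
    Set.BijOn (fun f : Module.End B V => f (j 1)) Set.univ (invariants hB V) :=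
  ⟨fun f _ => apply_one_mem_invariants hB f, fun _ _ _ _ h => hj.end_ext_one hB hA h,
    fun _ hs => (hj.exists_end_of_mem_invariants hB hs).imp fun _ h => ⟨trivial, h⟩⟩

end IsSelfInjectiveHull

end Hull

/-! ### The product on the hull induced from the tensor product -/

section Multiplication

variable {k : Type u} [CommRing k] {A : Type v} [Ring A] [Algebra k A]
  {B : Subalgebra k (Module.End k A)} (hB : multiplicationAlgebra k A ≤ B)
  {V : Type v} [AddCommGroup V] [Module B V] {j : A →ₗ[B] V}

variable (j) in
/-- The map `A ⊗ End_B(V) → V` with `a ⊗ f ↦ f (j a)`. -/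
noncomputable def evalTensor : InvariantTensor hB V →ₗ[B] V :=
  -- The lift is taken additively, with the balancing condition over `A^B` checked by hand, and
  -- `B`-linearity is added afterwards.
  let φ : InvariantTensor hB V →+ V :=
    TensorProduct.liftAddHom
      { toFun := fun a => (LinearMap.applyₗ' ℕ (j a)).toAddMonoidHom
        map_zero' := by ext f; simp
        map_add' := fun a b => by ext f; simp }
      (fun z a f => by
        change f (j (lmul hB (z : A) • a)) = lmul hB (z : A) • f (j a)
        rw [map_smul, map_smul])
  { φ with
    map_smul' := fun b x => by
      change φ (b • x) = b • φ x
      induction x using TensorProduct.induction_on with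
      | zero => simp
      | tmul a f =>
        rw [TensorProduct.smul_tmul']
        change f (j (b • a)) = b • f (j a)
        rw [map_smul, map_smul]
      | add x y hx hy => rw [smul_add, map_add, map_add, smul_add, hx, hy] }

@[simp] theorem evalTensor_tmul (a : A) (f : Module.End B V) :
    evalTensor hB j (a ⊗ₜ f) = f (j a) := rfl

/-- Multiplying by `a ⊗ f` on the left acts on values as `f ∘ L_a`, so the kernel is a left ideal.
-/
theorem evalTensor_tmul_mul (a : A) (f : Module.End B V) (y : InvariantTensor hB V) :
    evalTensor hB j ((a ⊗ₜ f) * y) = f (lmul hB a • evalTensor hB j y) := by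
  induction y using TensorProduct.induction_on with
  | zero => simp
  | tmul b g =>
    rw [Algebra.TensorProduct.tmul_mul_tmul, evalTensor_tmul, evalTensor_tmul, Module.End.mul_apply,
      ← map_smul, ← map_smul, lmul_smul]
  | add y z hy hz => rw [mul_add, map_add, hy, hz, map_add, smul_add, map_add]

namespace IsSelfInjectiveHull

/-- The mirror image needs `end_comm`: the product yields `g ∘ f` where `f ∘ g` is wanted. -/
theorem evalTensor_mul_tmul (hj : IsSelfInjectiveHull B A V j) (hA : IsBSemiprime B) (a : A)
    (f : Module.End B V) (y : InvariantTensor hB V) :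
    evalTensor hB j (y * (a ⊗ₜ f)) = f (rmul hB a • evalTensor hB j y) := by
  induction y using TensorProduct.induction_on with
  | zero => simp
  | tmul b g =>
    rw [Algebra.TensorProduct.tmul_mul_tmul, evalTensor_tmul, evalTensor_tmul, Module.End.mul_apply,
      ← map_smul, ← map_smul, rmul_smul, hj.end_comm hB hA]
  | add y z hy hz => rw [add_mul, map_add, hy, hz, map_add, smul_add, map_add]

theorem evalTensor_surjective (hj : IsSelfInjectiveHull B A V j) :
    Function.Surjective (evalTensor hB j) := by
  intro x
  induction x using hj.induction_on with
  | apply f a => exact ⟨a ⊗ₜ f, rfl⟩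
  | add x y hx hy =>
    obtain ⟨x, rfl⟩ := hx
    obtain ⟨y, rfl⟩ := hy
    exact ⟨x + y, map_add _ _ _⟩

theorem evalTensor_mul_eq_zero_right (y x : InvariantTensor hB V)
    (hx : evalTensor hB j x = 0) : evalTensor hB j (y * x) = 0 := by
  induction y using TensorProduct.induction_on with
  | zero => simp
  | tmul a f => rw [evalTensor_tmul_mul, hx, smul_zero, map_zero]
  | add y z hy hz => rw [add_mul, map_add, hy, hz, add_zero]

theorem evalTensor_mul_eq_zero_left (hj : IsSelfInjectiveHull B A V j) (hA : IsBSemiprime B)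
    (x y : InvariantTensor hB V) (hx : evalTensor hB j x = 0) : evalTensor hB j (x * y) = 0 := by
  induction y using TensorProduct.induction_on with
  | zero => simp
  | tmul a f => rw [hj.evalTensor_mul_tmul hB hA, hx, smul_zero, map_zero]
  | add y z hy hz => rw [mul_add, map_add, hy, hz, add_zero]

theorem evalTensor_mul_congr (hj : IsSelfInjectiveHull B A V j) (hA : IsBSemiprime B)
    {x x' y y' : InvariantTensor hB V} (hx : evalTensor hB j x = evalTensor hB j x')
    (hy : evalTensor hB j y = evalTensor hB j y') :
    evalTensor hB j (x * y) = evalTensor hB j (x' * y') := by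
  have h1 := hj.evalTensor_mul_eq_zero_left hB hA (x - x') y (by rw [map_sub, hx, sub_self])
  have h2 := evalTensor_mul_eq_zero_right hB x' (y - y')
    (show evalTensor hB j (y - y') = 0 by rw [map_sub, hy, sub_self])
  rw [sub_mul, map_sub, sub_eq_zero] at h1
  rw [mul_sub, map_sub, sub_eq_zero] at h2
  exact h1.trans h2

end IsSelfInjectiveHull

theorem lmul_one_smul (y : V) : lmul hB (1 : A) • y = y := by
  have h : lmul hB (1 : A) = 1 := Subtype.ext (LinearMap.ext one_mul)
  rw [h, one_smul]

theorem rmul_one_smul (y : V) : rmul hB (1 : A) • y = y := by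
  have h : rmul hB (1 : A) = 1 := Subtype.ext (LinearMap.ext mul_one)
  rw [h, one_smul]

/-- For `x : V` there is an endomorphism `e` fixing `x` such that `g ∘ e = 0` whenever
`g x = 0`. -/
theorem IsSelfInjectiveHull.exists_end_apply_eq_self (hj : IsSelfInjectiveHull B A V j)
    (hB : multiplicationAlgebra k A ≤ B) (hA : IsBSemiprime B) (x : V) :
    ∃ e : Module.End B V, e x = x ∧ ∀ g : Module.End B V, g x = 0 → g * e = 0 := by
  obtain ⟨C, hKC, hess⟩ := exists_disjoint_isEssential_sup (Submodule.span B {x})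
  set K := Submodule.span B {x}
  -- As `K` misses `C`, it embeds in `V ⧸ C`; extending the inclusion `K → V` along this embedding
  -- gives a map that is the identity on `K` and kills `C`. If `g x = 0`, then `g ∘ e` vanishes on
  -- the essential submodule `K ⊔ C`.
  obtain ⟨e, he⟩ := hj.extend (C.mkQ ∘ₗ K.subtype) (by
      rw [← LinearMap.ker_eq_bot, LinearMap.ker_comp, Submodule.ker_mkQ,
        ← Submodule.disjoint_iff_comap_eq_bot, disjoint_iff, hKC])
    (hj.generated.of_surjective _ C.mkQ_surjective).subgenerated K.subtype
  have hx : x ∈ K := Submodule.mem_span_singleton_self x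
  have heK : ∀ y ∈ K, e (C.mkQ y) = y := fun y hy => LinearMap.congr_fun he ⟨y, hy⟩
  refine ⟨e ∘ₗ C.mkQ, heK x hx, fun g hg => hj.end_eq_zero hB hA _ (hess.mono (sup_le ?_ ?_))⟩
  · refine (Submodule.span_singleton_le_iff_mem _ _).2 ?_
    change g (e (C.mkQ x)) = 0
    rw [heK x hx, hg]
  · intro y hy
    change g (e (C.mkQ y)) = 0
    rw [Submodule.mkQ_apply, (Submodule.Quotient.mk_eq_zero _).2 hy, map_zero, map_zero]

variable [Module k V]

/-- The multiplication on `V` is the one induced by `evalTensor`. -/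
structure IsHullMultiplication (j : A →ₗ[B] V) (μ : AlgebraStructure k V) : Prop where
  one : μ.one = j 1
  apply_mul : ∀ (f : Module.End B V) (a : A) (y : V), μ.mul (f (j a)) y = f (lmul hB a • y)
  mul_apply : ∀ (f : Module.End B V) (a : A) (y : V), μ.mul y (f (j a)) = f (rmul hB a • y)

namespace IsHullMultiplication

variable {hB} {μ : AlgebraStructure k V}

theorem map_mul_map (hμ : IsHullMultiplication hB j μ) (f g : Module.End B V) (a b : A) :
    μ.mul (f (j a)) (g (j b)) = f (g (j (a * b))) := by
  rw [hμ.apply_mul, ← lmul_smul hB, map_smul, map_smul, map_smul, map_smul]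

theorem j_mul (hμ : IsHullMultiplication hB j μ) (a : A) (y : V) :
    μ.mul (j a) y = lmul hB a • y := hμ.apply_mul 1 a y

theorem apply_one_mul (hμ : IsHullMultiplication hB j μ) (f : Module.End B V) (y : V) :
    μ.mul (f (j 1)) y = f y := by
  rw [hμ.apply_mul, lmul_one_smul]

theorem mul_apply_one (hμ : IsHullMultiplication hB j μ) (f : Module.End B V) (y : V) :
    μ.mul y (f (j 1)) = f y := by
  rw [hμ.mul_apply, rmul_one_smul]

end IsHullMultiplication

variable [IsScalarTower k B V]

theorem lmul_algebraMap (c : k) : lmul hB (algebraMap k A c) = algebraMap k B c := by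
  ext x
  exact (Algebra.smul_def c x).symm

theorem rmul_algebraMap (c : k) : rmul hB (algebraMap k A c) = algebraMap k B c := by
  ext x
  exact (Algebra.commutes c x).symm.trans (Algebra.smul_def c x).symm

/-- Scalars of `k` act on `V` through `B`, so they are realised in the tensor product by `c ⊗ 1`;
this makes the transported product `k`-bilinear. -/
theorem smul_evalTensor_left (c : k) (x y : InvariantTensor hB V) :
    evalTensor hB j (((algebraMap k A c) ⊗ₜ 1 * x) * y) = c • evalTensor hB j (x * y) := by
  rw [mul_assoc, evalTensor_tmul_mul, lmul_algebraMap, algebraMap_smul, Module.End.one_apply]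

theorem smul_evalTensor_right (hj : IsSelfInjectiveHull B A V j) (hA : IsBSemiprime B) (c : k)
    (x y : InvariantTensor hB V) :
    evalTensor hB j (x * (y * (algebraMap k A c) ⊗ₜ 1)) = c • evalTensor hB j (x * y) := by
  rw [← mul_assoc, hj.evalTensor_mul_tmul hB hA, rmul_algebraMap, algebraMap_smul,
    Module.End.one_apply]

theorem IsSelfInjectiveHull.exists_multiplication (hj : IsSelfInjectiveHull B A V j)
    (hA : IsBSemiprime B) : ∃ μ : AlgebraStructure k V, IsHullMultiplication hB j μ ∧
      ∀ x y, evalTensor hB j (x * y) = μ.mul (evalTensor hB j x) (evalTensor hB j y) := by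
  -- The product is computed on arbitrary preimages; `evalTensor_mul_congr` makes the choice
  -- irrelevant.
  choose σ hσ using hj.evalTensor_surjective hB
  have hmk : ∀ x y, evalTensor hB j (x * y) =
      evalTensor hB j (σ (evalTensor hB j x) * σ (evalTensor hB j y)) := fun x y =>
    hj.evalTensor_mul_congr hB hA (hσ _).symm (hσ _).symm
  have hone : evalTensor hB j 1 = j 1 := rfl
  let μ : AlgebraStructure k V :=
    { mul := LinearMap.mk₂ k (fun x y => evalTensor hB j (σ x * σ y))
        (fun x x' y => by
          rw [← map_add, ← add_mul]
          exact hj.evalTensor_mul_congr hB hA (by rw [map_add, hσ, hσ, hσ]) rfl)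
        (fun c x y => by
          rw [← smul_evalTensor_left hB]
          exact hj.evalTensor_mul_congr hB hA (by
            rw [hσ, evalTensor_tmul_mul, lmul_algebraMap, algebraMap_smul, hσ,
              Module.End.one_apply]) rfl)
        (fun x y y' => by
          rw [← map_add, ← mul_add]
          exact hj.evalTensor_mul_congr hB hA rfl (by rw [map_add, hσ, hσ, hσ]))
        (fun c x y => by
          rw [← smul_evalTensor_right hB hj hA]
          exact hj.evalTensor_mul_congr hB hA rfl (by
            rw [hσ, hj.evalTensor_mul_tmul hB hA, rmul_algebraMap, algebraMap_smul, hσ,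
              Module.End.one_apply]))
      one := j 1
      mul_assoc := fun x y z => by
        simp only [LinearMap.mk₂_apply]
        rw [hj.evalTensor_mul_congr hB hA (hσ _) rfl, mul_assoc]
        exact hj.evalTensor_mul_congr hB hA rfl (hσ _).symm
      one_mul := fun x => by
        simp only [LinearMap.mk₂_apply]
        rw [hj.evalTensor_mul_congr hB hA (x' := 1) ((hσ _).trans hone.symm) rfl, one_mul, hσ]
      mul_one := fun x => by
        simp only [LinearMap.mk₂_apply]
        rw [hj.evalTensor_mul_congr hB hA (y' := 1) rfl ((hσ _).trans hone.symm), mul_one, hσ] }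
  refine ⟨μ, ⟨rfl, fun f a y => ?_, fun f a y => ?_⟩, hmk⟩
  · change evalTensor hB j (σ (f (j a)) * σ y) = _
    rw [hj.evalTensor_mul_congr hB hA (x' := a ⊗ₜ f) ((hσ _).trans (evalTensor_tmul hB a f).symm)
      rfl, evalTensor_tmul_mul, hσ]
  · change evalTensor hB j (σ y * σ (f (j a))) = _
    rw [hj.evalTensor_mul_congr hB hA (y' := a ⊗ₜ f) rfl
      ((hσ _).trans (evalTensor_tmul hB a f).symm), hj.evalTensor_mul_tmul hB hA, hσ]

/-! ### The hull over the extended algebra -/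

namespace IsHullMultiplication

variable {hB} {μ : AlgebraStructure k V}

theorem end_mem_extendedB (hμ : IsHullMultiplication hB j μ) (f : Module.End B V) :
    f.restrictScalars k ∈ extendedB hB μ := by
  have h : f.restrictScalars k = μ.mul (f (j 1)) := LinearMap.ext fun y =>
    (hμ.apply_one_mul f y).symm
  rw [h]
  exact Algebra.subset_adjoin
    (Or.inr ⟨_, IsSelfInjectiveHull.apply_one_mem_invariants hB f, rfl⟩)

theorem lsmul_mem_extendedB (b : B) :
    Algebra.lsmul k k V b ∈ extendedB hB μ := Algebra.subset_adjoin (Or.inl ⟨b, rfl⟩)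

/-- To check a property of the action of `extendedB` it suffices to check it for `B` and for the
`B`-endomorphisms. -/
theorem extendedB_induction (hj : IsSelfInjectiveHull B A V j) (hμ : IsHullMultiplication hB j μ)
    {p : Module.End k V → Prop}
    (smul : ∀ b : B, p (Algebra.lsmul k k V b)) (apply : ∀ f : Module.End B V,
      p (f.restrictScalars k)) (add : ∀ x y, p x → p y → p (x + y))
    (mul : ∀ x y, p x → p y → p (x * y)) (x : Module.End k V) (hx : x ∈ extendedB hB μ) : p x := by
  induction hx using Algebra.adjoin_induction with
  | mem x hx =>
    obtain ⟨b, rfl⟩ | ⟨s, hs, rfl⟩ := hx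
    · exact smul b
    · obtain ⟨f, rfl⟩ := hj.exists_end_of_mem_invariants hB hs
      convert apply f using 1
      exact LinearMap.ext fun y => hμ.apply_one_mul f y
  | algebraMap c =>
    convert smul (algebraMap k B c) using 1
    ext y
    simp
  | add x y _ _ hx hy => exact add x y hx hy
  | mul x y _ _ hx hy => exact mul x y hx hy

variable (hB μ) in
/-- The `B`-submodule underlying a submodule over the extended algebra. -/
def toSubmodule (N : Submodule (extendedB hB μ) V) : Submodule B V where
  carrier := N
  zero_mem' := N.zero_mem
  add_mem' := N.add_mem
  smul_mem' b _ hx := N.smul_mem (⟨_, lsmul_mem_extendedB b⟩ : extendedB hB μ) hx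

/-- The submodule over the extended algebra generated by the image of a stable ideal of `A`. -/
def extend (hj : IsSelfInjectiveHull B A V j) (hμ : IsHullMultiplication hB j μ)
    (K : Submodule B A) : Submodule (extendedB hB μ) V :=
  let N : Submodule B V := ⨆ f : Module.End B V, K.map (f ∘ₗ j)
  have hN : ∀ (f : Module.End B V) (x : V), x ∈ N → f x ∈ N := by
    intro f
    change N ≤ N.comap f
    -- `f` carries the summand indexed by `g` into the one indexed by `f * g`.
    refine iSup_le fun g => ?_
    rw [← Submodule.map_le_iff_le_comap, ← Submodule.map_comp, ← LinearMap.comp_assoc]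
    exact le_iSup (fun f : Module.End B V => K.map (f ∘ₗ j)) (f * g)
  { N with
    smul_mem' := fun c x hx => by
      refine extendedB_induction hj hμ (p := fun c => ∀ x ∈ N, c x ∈ N) ?_ ?_ ?_ ?_ c.1 c.2 x hx
      · exact fun b x hx => N.smul_mem b hx
      · exact hN
      · exact fun c d hc hd x hx => N.add_mem (hc x hx) (hd x hx)
      · exact fun c d hc hd x hx => hc _ (hd x hx) }

theorem extend_induction {hj : IsSelfInjectiveHull B A V j} {hμ : IsHullMultiplication hB j μ}
    {K : Submodule B A} {p : V → Prop} (apply : ∀ (f : Module.End B V), ∀ a ∈ K, p (f (j a)))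
    (add : ∀ x y, p x → p y → p (x + y)) (x : V) (hx : x ∈ extend hj hμ K) : p x := by
  change x ∈ ⨆ f : Module.End B V, K.map (f ∘ₗ j) at hx
  induction hx using Submodule.iSup_induction' with
  | mem f x hx => obtain ⟨a, ha, rfl⟩ := hx; exact apply f a ha
  | zero => simpa using apply 0 0 K.zero_mem
  | add x y _ _ hx hy => exact add x y hx hy

theorem map_mem_extend (hj : IsSelfInjectiveHull B A V j) (hμ : IsHullMultiplication hB j μ)
    {K : Submodule B A} {a : A} (ha : a ∈ K) : j a ∈ extend hj hμ K :=
  (le_iSup (fun f : Module.End B V => K.map (f ∘ₗ j)) 1) ⟨a, ha, rfl⟩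

theorem eq_bot_of_comap (hj : IsSelfInjectiveHull B A V j) {N : Submodule (extendedB hB μ) V}
    (h : (toSubmodule hB μ N).comap j = ⊥) : N = ⊥ := by
  have h1 := hj.eq_bot_of_comap h
  refine (Submodule.eq_bot_iff N).2 fun x hx => ?_
  have : x ∈ toSubmodule hB μ N := hx
  rwa [h1] at this

/-- A `B`-linear extension exists by injectivity of the hull. It commutes with all `B`-endomorphisms
by `end_comm`, hence is linear over the extended algebra. -/
theorem isSelfInjective (hj : IsSelfInjectiveHull B A V j) (hμ : IsHullMultiplication hB j μ)
    (hA : IsBSemiprime B) : IsSelfInjective (extendedB hB μ) V := by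
  intro N f
  obtain ⟨g, hg⟩ := hj.extend (toSubmodule hB μ N).subtype (Submodule.injective_subtype _)
    hj.generated.subgenerated
    ({ toFun := fun x => f x
       map_add' := fun x y => f.map_add x y
       map_smul' := fun b x => f.map_smul (⟨_, lsmul_mem_extendedB b⟩ : extendedB hB μ) x } :
      toSubmodule hB μ N →ₗ[B] V)
  refine ⟨{ toFun := g, map_add' := g.map_add, map_smul' := fun c x => ?_ },
    fun x => LinearMap.congr_fun hg x⟩
  refine extendedB_induction hj hμ (p := fun c => ∀ x, g (c x) = c (g x)) ?_ ?_ ?_ ?_ c.1 c.2 x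
  · exact fun b x => g.map_smul b x
  · exact fun f x => hj.end_comm hB hA g f x
  · intro c d hc hd x
    rw [LinearMap.add_apply, map_add, hc, hd, LinearMap.add_apply]
  · intro c d hc hd x
    rw [Module.End.mul_apply, hc, hd, Module.End.mul_apply]

theorem isBSemiprime (hj : IsSelfInjectiveHull B A V j) (hμ : IsHullMultiplication hB j μ)
    (hA : IsBSemiprime B) :
    letI : Ring V := μ.toRing
    letI : Algebra k V := μ.toAlgebra
    IsBSemiprime (extendedB hB μ) := by
  let _ : Ring V := μ.toRing
  let _ : Algebra k V := μ.toAlgebra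
  intro N hN
  refine (eq_bot_of_comap hj (le_bot_iff.1 (hA _ fun x hx y hy => ?_))).le
  have h : μ.mul (j x) (j y) = 0 := hN _ hx _ hy
  rw [hμ.j_mul, ← map_smul, lmul_smul] at h
  exact hj.injective (h.trans (map_zero j).symm)

theorem isBPrime_iff (hj : IsSelfInjectiveHull B A V j) (hμ : IsHullMultiplication hB j μ) :
    letI : Ring V := μ.toRing
    letI : Algebra k V := μ.toAlgebra
    IsBPrime B ↔ IsBPrime (extendedB hB μ) := by
  let _ : Ring V := μ.toRing
  let _ : Algebra k V := μ.toAlgebra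
  constructor
  · intro hP K L hKL
    refine (hP ((toSubmodule hB μ K).comap j) ((toSubmodule hB μ L).comap j)
      fun x hx y hy => ?_).imp (fun h => (eq_bot_of_comap hj (le_bot_iff.1 h)).le)
      (fun h => (eq_bot_of_comap hj (le_bot_iff.1 h)).le)
    have h : μ.mul (j x) (j y) = 0 := hKL _ hx _ hy
    rw [hμ.j_mul, ← map_smul, lmul_smul] at h
    exact hj.injective (h.trans (map_zero j).symm)
  · intro hP K L hKL
    have hle : ∀ K : Submodule B A, extend hj hμ K ≤ ⊥ → K ≤ ⊥ := fun K h x hx =>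
      hj.injective ((h (map_mem_extend hj hμ hx)).trans (map_zero j).symm)
    refine (hP (extend hj hμ K) (extend hj hμ L) fun x hx y hy => ?_).imp (hle K) (hle L)
    change μ.mul x y = 0
    refine extend_induction (p := fun x => μ.mul x y = 0) (fun f a ha => ?_)
      (fun x z hx hz => by rw [map_add, LinearMap.add_apply, hx, hz, add_zero]) x hx
    refine extend_induction (p := fun y => μ.mul (f (j a)) y = 0) (fun g b hb => ?_)
      (fun y z hy hz => by rw [map_add, hy, hz, add_zero]) y hy
    rw [hμ.map_mul_map, hKL a ha b hb, map_zero, map_zero, map_zero]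

theorem multiplicationAlgebra_le (hj : IsSelfInjectiveHull B A V j)
    (hμ : IsHullMultiplication hB j μ) :
    letI : Ring V := μ.toRing
    letI : Algebra k V := μ.toAlgebra
    multiplicationAlgebra k V ≤ extendedB hB μ := by
  let _ : Ring V := μ.toRing
  let _ : Algebra k V := μ.toAlgebra
  refine Algebra.adjoin_le ?_
  rintro _ (⟨x, rfl⟩ | ⟨x, rfl⟩)
  · change μ.mul x ∈ extendedB hB μ
    induction x using hj.induction_on with
    | apply f a =>
      have h : μ.mul (f (j a)) = f.restrictScalars k * Algebra.lsmul k k V (lmul hB a) :=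
        LinearMap.ext fun y => hμ.apply_mul f a y
      rw [h]
      exact mul_mem (hμ.end_mem_extendedB f) (lsmul_mem_extendedB _)
    | add x y hx hy => rw [map_add]; exact add_mem hx hy
  · change μ.mul.flip x ∈ extendedB hB μ
    induction x using hj.induction_on with
    | apply f a =>
      have h : μ.mul.flip (f (j a)) = f.restrictScalars k * Algebra.lsmul k k V (rmul hB a) :=
        LinearMap.ext fun y => hμ.mul_apply f a y
      rw [h]
      exact mul_mem (hμ.end_mem_extendedB f) (lsmul_mem_extendedB _)
    | add x y hx hy => rw [map_add]; exact add_mem hx hy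

theorem exists_algHom (hj : IsSelfInjectiveHull B A V j) (hμ : IsHullMultiplication hB j μ) :
    letI : Ring V := μ.toRing
    letI : Algebra k V := μ.toAlgebra
    ∃ i : A →ₐ[k] V, Function.Injective i ∧ ∀ a, i a = j a := by
  let _ : Ring V := μ.toRing
  let _ : Algebra k V := μ.toAlgebra
  have hmul : ∀ a b, j (a * b) = μ.mul (j a) (j b) := fun a b => by
    rw [hμ.j_mul, ← map_smul, lmul_smul]
  refine ⟨AlgHom.ofLinearMap (j.restrictScalars k) hμ.one.symm hmul, hj.injective, fun _ => rfl⟩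

theorem exists_subalgebra (hj : IsSelfInjectiveHull B A V j) (hμ : IsHullMultiplication hB j μ)
    (hA : IsBSemiprime B) :
    letI : Ring V := μ.toRing
    letI : Algebra k V := μ.toAlgebra
    ∃ S : Subalgebra k V, (∀ s, s ∈ S ↔ s ∈ invariants hB V) ∧
      S ≤ Subalgebra.center k V ∧ IsNonsingular S V := by
  let _ : Ring V := μ.toRing
  let _ : Algebra k V := μ.toAlgebra
  let S : Subalgebra k V :=
    { invariants hB V with
      mul_mem' := by
        intro s t hs ht
        obtain ⟨f, rfl⟩ := hj.exists_end_of_mem_invariants hB hs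
        obtain ⟨g, rfl⟩ := hj.exists_end_of_mem_invariants hB ht
        change μ.mul (f (j 1)) (g (j 1)) ∈ invariants hB V
        rw [hμ.apply_one_mul]
        exact IsSelfInjectiveHull.apply_one_mem_invariants hB (f ∘ₗ g)
      algebraMap_mem' := by
        intro c
        change c • μ.one ∈ invariants hB V
        rw [hμ.one]
        exact Submodule.smul_mem _ c (IsSelfInjectiveHull.apply_one_mem_invariants hB 1) }
  have hS : ∀ f : Module.End B V, f (j 1) ∈ S :=
    IsSelfInjectiveHull.apply_one_mem_invariants hB
  have hsmul : ∀ (f : Module.End B V) (y : V), (⟨f (j 1), hS f⟩ : S) • y = f y :=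
    hμ.apply_one_mul
  refine ⟨S, fun _ => Iff.rfl, fun s hs => ?_, fun x hx => ?_⟩
  · obtain ⟨f, rfl⟩ := hj.exists_end_of_mem_invariants hB hs
    rw [Subalgebra.mem_center_iff]
    exact fun y => (hμ.mul_apply_one f y).trans (hμ.apply_one_mul f y).symm
  · obtain ⟨e, hex, he⟩ := hj.exists_end_apply_eq_self hB hA x
    -- The ideal generated by `e(1)` misses the annihilator of `x`: if `g(1) e(1)` kills `x = e x`,
    -- then `g x = 0`, so `g * e = 0`. Essentiality of the annihilator forces `e(1) = 0`, hence `e =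
    -- 0` and `x = e x = 0`.
    have h1 := hx (Submodule.span S {⟨e (j 1), hS e⟩}) (by
      rw [eq_bot_iff]
      rintro r ⟨hr, hrx⟩
      obtain ⟨⟨c, hc⟩, rfl⟩ := Submodule.mem_span_singleton.1 hr
      obtain ⟨g, rfl⟩ := hj.exists_end_of_mem_invariants hB hc
      have hg : g x = 0 := by
        have h2 : ((⟨g (j 1), hc⟩ : S) • (⟨e (j 1), hS e⟩ : S)) • x = 0 := hrx
        rwa [smul_assoc, hsmul, hsmul, hex] at h2
      have h2 : (⟨g (j 1), hc⟩ : S) • (⟨e (j 1), hS e⟩ : S) = 0 := Subtype.ext <|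
        (hμ.apply_one_mul g _).trans (LinearMap.congr_fun (he g hg) (j 1))
      exact (Submodule.mem_bot S).2 h2)
    rw [Submodule.span_singleton_eq_bot] at h1
    have h2 : e = 0 := hj.end_ext_one hB hA (congrArg Subtype.val h1)
    rw [← hex, h2, LinearMap.zero_apply]

end IsHullMultiplication

end Multiplication

/-! ### Invariants as a direct limit of partial homomorphisms -/

section HomLimit

variable {k : Type u} [CommRing k] {A : Type v} [Ring A] [Algebra k A]
  {B : Subalgebra k (Module.End k A)} (hB : multiplicationAlgebra k A ≤ B)
  {V : Type v} [AddCommGroup V] [Module B V] {j : A →ₗ[B] V}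

theorem EssentialSubmodule.isEssential (I : EssentialSubmodule B A) : IsEssential I.sub := I.2

namespace IsSelfInjectiveHull

theorem exists_extend_partial (hj : IsSelfInjectiveHull B A V j) {I : Submodule B A}
    (f : I →ₗ[B] A) : ∃ g : Module.End B V, ∀ x : I, g (j x) = j (f x) := by
  obtain ⟨g, hg⟩ := hj.extend (j ∘ₗ I.subtype) (hj.injective.comp I.injective_subtype)
    hj.generated.subgenerated (j ∘ₗ f)
  exact ⟨g, fun x => LinearMap.congr_fun hg x⟩

/-- The extension to `V` of a homomorphism from a submodule of `A` to `A`. -/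
noncomputable def extendPartial (hj : IsSelfInjectiveHull B A V j) {I : Submodule B A}
    (f : I →ₗ[B] A) : Module.End B V := (hj.exists_extend_partial f).choose

theorem extendPartial_apply (hj : IsSelfInjectiveHull B A V j) {I : Submodule B A}
    (f : I →ₗ[B] A) (x : I) : hj.extendPartial f (j x) = j (f x) :=
  (hj.exists_extend_partial f).choose_spec x

theorem extendPartial_eq (hj : IsSelfInjectiveHull B A V j) (hB : multiplicationAlgebra k A ≤ B)
    (hA : IsBSemiprime B) {I : Submodule B A} (hI : IsEssential I) (f : I →ₗ[B] A)
    {g : Module.End B V} (hg : ∀ x : I, g (j x) = j (f x)) : hj.extendPartial f = g :=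
  hj.end_ext hB hA hI fun x hx => (hj.extendPartial_apply f ⟨x, hx⟩).trans (hg ⟨x, hx⟩).symm

variable [Module k V] [IsScalarTower k B V]

theorem map_smul_base (f : A →ₗ[B] V) (c : k) (a : A) : f (c • a) = c • f a := by
  rw [← algebraMap_smul B c a, map_smul, algebraMap_smul]

/-- Evaluation at `1` of the extensions of homomorphisms `I → A`. -/
noncomputable def extendPartialOne (hj : IsSelfInjectiveHull B A V j) (hA : IsBSemiprime B)
    (I : EssentialSubmodule B A) : (I.sub →ₗ[B] A) →ₗ[k] invariants hB V where
  toFun f := ⟨hj.extendPartial f (j 1), apply_one_mem_invariants hB _⟩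
  -- The sum of the extensions extends the sum, and extensions from an essential ideal are unique.
  map_add' f g := Subtype.ext <| LinearMap.congr_fun
    (hj.extendPartial_eq hB hA I.isEssential (f + g)
    (g := hj.extendPartial f + hj.extendPartial g) fun x => by
      rw [LinearMap.add_apply, extendPartial_apply, extendPartial_apply, LinearMap.add_apply,
        map_add]) (j 1)
  map_smul' c f := Subtype.ext <| LinearMap.congr_fun
    (hj.extendPartial_eq hB hA I.isEssential (c • f)
    (g := c • hj.extendPartial f) fun x => by
      rw [LinearMap.smul_apply, extendPartial_apply, LinearMap.smul_apply, map_smul_base]) (j 1)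

instance : IsDirectedOrder (EssentialSubmodule B A) where
  directed I J := ⟨OrderDual.toDual ⟨I.sub ⊓ J.sub, I.isEssential.inf J.isEssential⟩,
    inf_le_left (a := I.sub), inf_le_right (a := I.sub)⟩

instance : Nonempty (EssentialSubmodule B A) := ⟨OrderDual.toDual ⟨⊤, isEssential_top⟩⟩

open Classical in
/-- The map from the direct limit of the `Hom_B(I, A)` to the invariants. -/
noncomputable def ofHomLimit (hj : IsSelfInjectiveHull B A V j) (hA : IsBSemiprime B) :
    HomLimit k B A →ₗ[k] invariants hB V :=
  Module.DirectLimit.lift k _ _ _ (hj.extendPartialOne hB hA) fun _ J hIJ f => Subtype.ext <|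
    LinearMap.congr_fun (hj.extendPartial_eq hB hA J.isEssential _ fun x =>
      hj.extendPartial_apply f (Submodule.inclusion hIJ x)) (j 1)

theorem ofHomLimit_mk (hj : IsSelfInjectiveHull B A V j) (hA : IsBSemiprime B)
    (I : EssentialSubmodule B A) (f : I.sub →ₗ[B] A) :
    (hj.ofHomLimit hB hA (HomLimit.mk k I f) : V) = hj.extendPartial f (j 1) := by
  classical
  exact congrArg Subtype.val (Module.DirectLimit.lift_of _ _ _)

theorem ofHomLimit_bijective (hj : IsSelfInjectiveHull B A V j) (hA : IsBSemiprime B) :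
    Function.Bijective (hj.ofHomLimit (k := k) hB hA) := by
  classical
  constructor
  · rw [injective_iff_map_eq_zero]
    intro z hz
    obtain ⟨I, f, rfl⟩ := Module.DirectLimit.exists_of z
    have h : hj.extendPartial f = 0 := hj.end_ext_one hB hA
      ((hj.ofHomLimit_mk hB hA I f).symm.trans (congrArg Subtype.val hz))
    have hf : f = 0 := LinearMap.ext fun x => hj.injective <| by
      rw [← hj.extendPartial_apply f, h, LinearMap.zero_apply, LinearMap.zero_apply, map_zero]
    rw [hf, map_zero]
  · rintro ⟨s, hs⟩
    obtain ⟨g, rfl⟩ := hj.exists_end_of_mem_invariants hB hs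
    -- The largest ideal that `g` maps into `A`; it is essential as a preimage of the essential
    -- submodule `A`.
    let I : EssentialSubmodule B A := OrderDual.toDual
      ⟨(LinearMap.range j).comap (g ∘ₗ j), hj.essential.comap _⟩
    have hI : ∀ x : I.sub, (g ∘ₗ j ∘ₗ I.sub.subtype) x ∈ LinearMap.range j := fun x => x.2
    let f : I.sub →ₗ[B] A := (LinearEquiv.ofInjective j hj.injective).symm.toLinearMap ∘ₗ
      (g ∘ₗ j ∘ₗ I.sub.subtype).codRestrict (LinearMap.range j) hI
    have hf : ∀ x : I.sub, g (j x) = j (f x) := fun x =>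
      (congrArg Subtype.val ((LinearEquiv.ofInjective j hj.injective).apply_symm_apply
        ⟨g (j x), hI x⟩)).symm
    refine ⟨HomLimit.mk k I f, Subtype.ext ?_⟩
    exact (hj.ofHomLimit_mk hB hA I f).trans
      (LinearMap.congr_fun (hj.extendPartial_eq hB hA I.isEssential f hf) (j 1))

theorem exists_homLimit_equiv (hj : IsSelfInjectiveHull B A V j) (hA : IsBSemiprime B)
    {μ : AlgebraStructure k V} (hμ : IsHullMultiplication hB j μ) :
    ∃ Φ : HomLimit k B A ≃ₗ[k] invariants hB V,
      (∀ (I : EssentialSubmodule B A) (f : I.sub →ₗ[B] A) (x : I.sub),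
        lmul hB (x : A) • (Φ (HomLimit.mk k I f) : V) = j (f x)) ∧
      ∀ (I J K : EssentialSubmodule B A) (f : I.sub →ₗ[B] A) (g : J.sub →ₗ[B] A)
        (h : K.sub →ₗ[B] A) (hKJ : K.sub ≤ J.sub)
        (hgI : ∀ x : K.sub, g (Submodule.inclusion hKJ x) ∈ I.sub),
        (∀ x : K.sub, h x = f ⟨g (Submodule.inclusion hKJ x), hgI x⟩) →
        (Φ (HomLimit.mk k K h) : V)
          = μ.mul (Φ (HomLimit.mk k J g)) (Φ (HomLimit.mk k I f)) := by
  refine ⟨LinearEquiv.ofBijective _ (hj.ofHomLimit_bijective hB hA), fun I f x => ?_,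
    fun I J K f g h hKJ hgI hh => ?_⟩
  · rw [LinearEquiv.ofBijective_apply, ofHomLimit_mk, lmul_smul_apply_one, extendPartial_apply]
  · rw [LinearEquiv.ofBijective_apply, LinearEquiv.ofBijective_apply,
      LinearEquiv.ofBijective_apply, ofHomLimit_mk, ofHomLimit_mk, ofHomLimit_mk, hμ.mul_apply_one]
    -- The composite of the two extensions extends the composite `h` from the essential ideal `K`.
    refine LinearMap.congr_fun (hj.extendPartial_eq hB hA K.isEssential h
      (g := hj.extendPartial f * hj.extendPartial g) fun x => ?_) (j 1)
    rw [Module.End.mul_apply, hh]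
    exact (congrArg _ (hj.extendPartial_apply g (Submodule.inclusion hKJ x))).trans
      (hj.extendPartial_apply f ⟨_, hgI x⟩)

end IsSelfInjectiveHull

end HomLimit

/-! ### Assembly of the theorem -/

theorem IsSelfInjectiveHull.exists_evalTensor {k : Type u} [CommRing k] {A : Type v} [Ring A]
    [Algebra k A] {B : Subalgebra k (Module.End k A)} (hB : multiplicationAlgebra k A ≤ B)
    {V : Type v} [AddCommGroup V] [Module B V] {j : A →ₗ[B] V}
    (hj : IsSelfInjectiveHull B A V j) (hA : IsBSemiprime B) [Module k V]
    {μ : AlgebraStructure k V} (hφ : ∀ x y, evalTensor hB j (x * y) =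
      μ.mul (evalTensor hB j x) (evalTensor hB j y)) :
    ∃ φ : InvariantTensor hB V →ₗ[B] V, (∀ a f, φ (a ⊗ₜ f) = f (j a)) ∧
      Function.Surjective φ ∧ (∀ x y, φ y = 0 → φ (x * y) = 0 ∧ φ (y * x) = 0) ∧
      ∀ x y, φ (x * y) = μ.mul (φ x) (φ y) :=
  ⟨evalTensor hB j, evalTensor_tmul hB, hj.evalTensor_surjective hB, fun x y hy =>
    ⟨evalTensor_mul_eq_zero_right hB x y hy, hj.evalTensor_mul_eq_zero_left hB hA y x hy⟩, hφ⟩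

theorem IsHullMultiplication.smul_mul_smul {k : Type u} [CommRing k] {A : Type v} [Ring A]
    [Algebra k A] {B : Subalgebra k (Module.End k A)} {hB : multiplicationAlgebra k A ≤ B}
    {V : Type v} [AddCommGroup V] [Module B V] {j : A →ₗ[B] V} [Module k V] [IsScalarTower k B V]
    {μ : AlgebraStructure k V} (hμ : IsHullMultiplication hB j μ)
    (hj : IsSelfInjectiveHull B A V j) (a b : A) {s t : V} (hs : s ∈ invariants hB V)
    (ht : t ∈ invariants hB V) :
    μ.mul (lmul hB a • s) (lmul hB b • t) = lmul hB (a * b) • μ.mul s t := by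
  obtain ⟨f, rfl⟩ := hj.exists_end_of_mem_invariants hB hs
  obtain ⟨g, rfl⟩ := hj.exists_end_of_mem_invariants hB ht
  rw [IsSelfInjectiveHull.lmul_smul_apply_one, IsSelfInjectiveHull.lmul_smul_apply_one,
    hμ.map_mul_map, hμ.apply_one_mul]
  exact (IsSelfInjectiveHull.lmul_smul_apply_one hB (f ∘ₗ g) (a * b)).symm

end CentralClosure

theorem theorem3p2 {k : Type u} [CommRing k] {A : Type v} [Ring A] [Algebra k A]
    (B : Subalgebra k (Module.End k A)) (hB : multiplicationAlgebra k A ≤ B)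
    (hA : IsBSemiprime B)
    {E : Type v} [AddCommGroup E] [Module B E] [Module k E] [IsScalarTower k B E]
    (ι : A →ₗ[B] E) (hE : IsInjectiveHull B A E ι) :
    -- the self-injective hull of `A` is the Lambek quotient module of `A`
    IsLambekQuotient B A (Hull B A E) (toHull ι) ∧
    -- evaluation at `1` is a bijection from the endomorphisms onto the invariants of the hull
    Set.BijOn (fun f : Module.End B (Hull B A E) => f (toHull ι 1)) Set.univ
      (invariants hB (Hull B A E)) ∧
    -- the algebra structure `μ` on the hull
    ∃ μ : AlgebraStructure k (Hull B A E),
      -- the invariants as a direct limit: `[f : I → A]` corresponds to the invariant `s` with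
      -- `x s = f x` for all `x ∈ I`, and composition of maps corresponds to multiplication
      (∃ Φ : HomLimit k B A ≃ₗ[k] invariants hB (Hull B A E),
        (∀ (I : EssentialSubmodule B A) (f : I.sub →ₗ[B] A) (x : I.sub),
          lmul hB (x : A) • (Φ (HomLimit.mk k I f) : Hull B A E)
            = toHull ι (f x)) ∧
        ∀ (I J K : EssentialSubmodule B A) (f : I.sub →ₗ[B] A) (g : J.sub →ₗ[B] A)
          (h : K.sub →ₗ[B] A) (hKJ : K.sub ≤ J.sub)
          (hgI : ∀ x : K.sub, g (Submodule.inclusion hKJ x) ∈ I.sub),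
          (∀ x : K.sub, h x = f ⟨g (Submodule.inclusion hKJ x), hgI x⟩) →
          (Φ (HomLimit.mk k K h) : Hull B A E)
            = μ.mul (Φ (HomLimit.mk k J g)) (Φ (HomLimit.mk k I f))) ∧
      -- the map `a ⊗ f ↦ f a`, its kernel, and the induced multiplication
      (∃ φ : InvariantTensor hB (Hull B A E) →ₗ[B] Hull B A E,
        (∀ a f, φ (a ⊗ₜ f) = f (toHull ι a)) ∧
        Function.Surjective φ ∧
        (∀ x y, φ y = 0 → φ (x * y) = 0 ∧ φ (y * x) = 0) ∧
        ∀ x y, φ (x * y) = μ.mul (φ x) (φ y)) ∧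
      -- `(a s)(b t) = (a b) s t`, where the product of invariants corresponds to the composition
      -- of endomorphisms
      (∀ a b : A, ∀ s ∈ invariants hB (Hull B A E),
        ∀ t ∈ invariants hB (Hull B A E),
        μ.mul (lmul hB a • s) (lmul hB b • t) = lmul hB (a * b) • μ.mul s t) ∧
      (∀ f g : Module.End B (Hull B A E),
        μ.mul (f (toHull ι 1)) (g (toHull ι 1)) = g (f (toHull ι 1))) ∧
      letI : Ring (Hull B A E) := μ.toRing
      letI : Algebra k (Hull B A E) := μ.toAlgebra
      -- `A` is a subalgebra of the hull
      (∃ j : A →ₐ[k] Hull B A E, Function.Injective j ∧ ∀ a, j a = toHull ι a) ∧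
      -- the hull with `⟨B, invariants⟩` is again an extension with additional module structure
      multiplicationAlgebra k (Hull B A E) ≤ extendedB hB μ ∧
      -- semiprimeness and self-injectivity
      IsBSemiprime (extendedB hB μ) ∧
      IsSelfInjective (extendedB hB μ) (Hull B A E) ∧
      -- the invariants form a central subalgebra, over which the hull is non-singular
      (∃ S : Subalgebra k (Hull B A E),
        (∀ s, s ∈ S ↔ s ∈ invariants hB (Hull B A E)) ∧
        S ≤ Subalgebra.center k (Hull B A E) ∧
        IsNonsingular S (Hull B A E)) ∧
      -- primeness
      (IsBPrime B ↔ IsBPrime (extendedB hB μ)) := by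
  have hj := hE.isSelfInjectiveHull
  obtain ⟨μ, hμ, hφ⟩ := hj.exists_multiplication hB hA
  refine ⟨hj.isLambekQuotient hB hA, hj.bijOn_apply_one hB hA, μ,
    hj.exists_homLimit_equiv hB hA hμ, hj.exists_evalTensor hB hA hφ,
    fun a b s hs t ht => hμ.smul_mul_smul hj a b hs ht, fun f g => hμ.mul_apply_one g _,
    hμ.exists_algHom hj, hμ.multiplicationAlgebra_le hj, hμ.isBSemiprime hj hA,
    hμ.isSelfInjective hj hA, hμ.exists_subalgebra hj hA, hμ.isBPrime_iff hj⟩
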